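/- Let $R$ be a noetherian local ring whose formal completion $\hat R=\varprojlim_n R/\mathfrak m_R^n$ is an integral domain. Let $p\ge 1$ be the characteristic exponent of the field of fractions $\operatorname{Frac}(R)$ (so $p=1$ if it has characteristic zero, and $p$ equals its characteristic otherwise), and let $$R^{\mathrm{prc}}=\{\,b\in\hat R \mid b^{p^\nu}\in R \text{ for some } \nu\ge 0\,\}$$ be the $p$-radical closure of $R$; it is a subring of $\hat R$ containing $R$. Let $R\subset B\subset R^{\mathrm{prc}}$ be an intermediate ring. Then $B$ is a local domain and the inclusion $B\subset\hat R$ is a local homomorphism; write $\hat B=\varprojlim_n B/\mathfrak m_B^n$ for the formal completion of $B$ (which is not assumed to be noetherian), and $\hat B\to\hat R$ for the map on completions induced by the inclusion $B\subset\hat R$, using that the local ring $\hat R$ is complete. Proposition 3.9. The following are equivalent: 1. The ring $B$ is noetherian and its generic formal fiber $\hat B\otimes_B\operatorname{Frac}(B)$ is reduced. 2. The ring extension $B\subset\hat R$ is flat and the induced map $\hat B\to\hat R$ is injective. -/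

import Mathlib

open IsLocalRing
open scoped TensorProduct

universe u v

namespace PRadical

/-- The formal completion `Â = lim A / 𝔪_A ^ n` of a local ring `A` (noetherian or not). -/
abbrev FormalCompletion (A : Type u) [CommRing A] [IsLocalRing A] : Type u :=
  AdicCompletion (maximalIdeal A) A

/-- The generic formal fibers of the local ring `A` are reduced: the rings `Â ⊗[A] κ(𝔭)` are
reduced for all minimal primes `𝔭` of `A`. If `A` is a domain, the only minimal prime is `0`, and
`κ(0)` is the field of fractions. -/
def HasReducedGenericFormalFibers (A : Type u) [CommRing A] [IsLocalRing A] : Prop :=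
  ∀ (𝔭 : Ideal A) [𝔭.IsPrime], 𝔭 ∈ minimalPrimes A →
    IsReduced (FormalCompletion A ⊗[A] 𝔭.ResidueField)

section LocalMap

variable {A : Type u} {C : Type v} [CommRing A] [IsLocalRing A] [CommRing C] [IsLocalRing C]

theorem maximalIdeal_pow_le_comap (φ : A →+* C) [IsLocalHom φ] (n : ℕ) :
    maximalIdeal A ^ n ≤ (maximalIdeal C ^ n).comap φ := by
  rw [← Ideal.map_le_iff_le_comap, Ideal.map_pow]
  exact Ideal.pow_right_mono (((IsLocalRing.local_hom_TFAE φ).out 0 2).mp ‹_›) n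

/-- The maps `Â → A / 𝔪_A ^ n → C / 𝔪_C ^ n` induced by a local homomorphism `φ : A → C`. -/
noncomputable def truncatedMap (φ : A →+* C) [IsLocalHom φ] (n : ℕ) :
    FormalCompletion A →+* C ⧸ maximalIdeal C ^ n :=
  (Ideal.quotientMap (maximalIdeal C ^ n) φ (maximalIdeal_pow_le_comap φ n)).comp
    (AdicCompletion.evalₐ (maximalIdeal A) n : FormalCompletion A →+* A ⧸ maximalIdeal A ^ n)

theorem factorPow_comp_truncatedMap (φ : A →+* C) [IsLocalHom φ] {m n : ℕ} (hle : m ≤ n) :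
    (Ideal.Quotient.factorPow (maximalIdeal C) hle).comp (truncatedMap φ n) =
      truncatedMap φ m := by
  ext x
  obtain ⟨x, rfl⟩ := AdicCompletion.mk_surjective _ _ x
  have h := congrArg (Ideal.quotientMap (maximalIdeal C ^ m) φ (maximalIdeal_pow_le_comap φ m))
    (AdicCompletion.Ideal.mk_eq_mk (maximalIdeal A) hle x)
  simp only [truncatedMap, RingHom.comp_apply, RingHom.coe_coe, AdicCompletion.evalₐ_mk,
    Ideal.quotientMap_mk] at h ⊢
  exact h

/-- The map `Â → C` induced by a local homomorphism `φ : A → C` into a complete local ring `C`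
(so that `C = Ĉ`): it is the map on inverse limits
induced by the maps `A / 𝔪_A ^ n → C / 𝔪_C ^ n`. -/
noncomputable def completionLift (φ : A →+* C) [IsLocalHom φ] [IsAdicComplete (maximalIdeal C) C] :
    FormalCompletion A →+* C :=
  IsAdicComplete.liftRingHom (maximalIdeal C) (truncatedMap φ) (factorPow_comp_truncatedMap φ)

end LocalMap

section Closure

variable (R : Type u) [CommRing R] [IsLocalRing R] [IsNoetherianRing R]

theorem algebraMap_formalCompletion_injective :
    Function.Injective (algebraMap R (FormalCompletion R)) :=
  AdicCompletion.of_injective (maximalIdeal R) R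

variable [IsDomain (FormalCompletion R)]

theorem isDomain_of_formalCompletion : IsDomain R :=
  (algebraMap_formalCompletion_injective R).isDomain _

theorem expChar_formalCompletion :
    ExpChar (FormalCompletion R) (ringExpChar (FractionRing R)) := by
  have := isDomain_of_formalCompletion R
  have : ExpChar R (ringExpChar (FractionRing R)) :=
    (RingHom.expChar_iff (algebraMap R (FractionRing R))
      (IsFractionRing.injective R (FractionRing R)) _).mpr inferInstance
  exact expChar_of_injective_algebraMap (algebraMap_formalCompletion_injective R) _

/-- The `p`-radical closure of a local noetherian ring `R` whose formal completion `R̂` is a domain: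
the subring of all `b ∈ R̂` with `b ^ (p ^ ν) ∈ R` for some `ν ≥ 0`, where
`p ≥ 1` is the characteristic exponent of the field of fractions of `R`. -/
def pRadicalClosure : Subalgebra R (FormalCompletion R) where
  carrier := {b | ∃ ν : ℕ,
    b ^ ringExpChar (FractionRing R) ^ ν ∈ (algebraMap R (FormalCompletion R)).range}
  mul_mem' := by
    rintro a b ⟨m, hm⟩ ⟨n, hn⟩
    refine ⟨m + n, ?_⟩
    rw [mul_pow]
    refine mul_mem ?_ ?_
    · rw [pow_add, pow_mul]; exact pow_mem hm _
    · rw [add_comm, pow_add, pow_mul]; exact pow_mem hn _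
  add_mem' := by
    have := expChar_formalCompletion R
    rintro a b ⟨m, hm⟩ ⟨n, hn⟩
    refine ⟨m + n, ?_⟩
    rw [add_pow_expChar_pow]
    refine add_mem ?_ ?_
    · rw [pow_add, pow_mul]; exact pow_mem hm _
    · rw [add_comm, pow_add, pow_mul]; exact pow_mem hn _
  algebraMap_mem' r := ⟨0, by simp⟩

variable {R}

/-- An element of an intermediate ring `B` that is a unit in `R̂` is a unit in `B`. -/
theorem isLocalHom_of_le {B : Subalgebra R (FormalCompletion R)} (hB : B ≤ pRadicalClosure R) :
    IsLocalHom (algebraMap B (FormalCompletion R)) := by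
  refine ⟨fun b hb => ?_⟩
  obtain ⟨ν, r, hr⟩ := hB b.2
  have hu : IsUnit (algebraMap R (FormalCompletion R) r) := by
    rw [hr]; exact IsUnit.pow _ hb
  have hr' : IsUnit r := isUnit_of_map_unit _ _ hu
  have h : b ^ ringExpChar (FractionRing R) ^ ν = algebraMap R B r := by
    apply Subtype.ext
    simpa using hr.symm
  have hpos : ringExpChar (FractionRing R) ^ ν ≠ 0 :=
    pow_ne_zero _ (by simp [ringExpChar])
  exact (isUnit_pow_iff hpos).mp (h ▸ hr'.map (algebraMap R B))

/-- The intermediate rings between `R` and its `p`-radical closure are local. -/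
theorem isLocalRing_of_le {B : Subalgebra R (FormalCompletion R)} (hB : B ≤ pRadicalClosure R) :
    IsLocalRing B :=
  have := isLocalHom_of_le hB
  RingHom.domain_isLocalRing (algebraMap B (FormalCompletion R))

end Closure

end PRadical

/-! ### Adic completions: kernels of truncations, functoriality, noetherianity -/

namespace AdicCompletion

variable {R : Type*} [CommRing R] (I : Ideal R)

/-! The map `B̂ → R̂` is always surjective, since `R̂ → B̂ → R̂` is the identity
(`completionLift_surjective`). If `B` is noetherian, finitely many generators of `𝔪_B` have `p ^
ν`-th powers in `R` for one common `ν`. As Frobenius is additive, the `p ^ ν`-th power of every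
element of `B` is then an `𝔪_B`-adic limit of elements of `R`. Hence elements of the kernel of `B̂ →
R̂` are nilpotent (`completionLift_injective`). A reduced generic formal fiber makes `B̂` reduced,
so `B̂ ≅ R̂`, which is flat over the noetherian ring `B`. Conversely, a flat local map `B → R̂` is
faithfully flat, so `B` inherits noetherianity from `R̂`; and `B̂`, embedded in the domain `R̂`, is
reduced, as are its localizations. -/

theorem mem_map_pow_of_evalₐ_eq_zero (hI : I.FG) (n : ℕ) {x : AdicCompletion I R}
    (hx : evalₐ I n x = 0) : x ∈ (I ^ n).map (algebraMap R (AdicCompletion I R)) := by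
  rw [← Submodule.restrictScalars_mem R, ← Ideal.smul_top_eq_map, pow_smul_top_eq_ker_eval hI,
    LinearMap.mem_ker]
  rw [← factor_evalₐ_eq_eval I x (Ideal.mul_top _).ge, hx]
  exact _root_.map_zero (Ideal.Quotient.factor _)

theorem evalₐ_eq_zero_of_mem {n : ℕ} {x : AdicCompletion I R}
    (hx : x ∈ (I ^ n).map (algebraMap R (AdicCompletion I R))) : evalₐ I n x = 0 := by
  suffices h : (I ^ n).map (algebraMap R (AdicCompletion I R)) ≤
      RingHom.ker (evalₐ I n) from h hx
  rw [Ideal.map_le_iff_le_comap]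
  intro r hr
  rw [Ideal.mem_comap, RingHom.mem_ker, AlgHom.commutes]
  exact Ideal.Quotient.eq_zero_iff_mem.mpr hr

section Noetherian

variable {A S : Type*} [CommRing A] [CommRing S] (J : Ideal A) (K : Ideal S) (f : A →+* S)

theorem pow_le_comap_pow {J : Ideal A} {K : Ideal S} {f : A →+* S}
    (h : J.map f ≤ K) (n : ℕ) :
    J ^ n ≤ (K ^ n).comap f := by
  rw [← Ideal.map_le_iff_le_comap, Ideal.map_pow]
  exact Ideal.pow_right_mono h n

/-- The maps `lim A / J ^ n → A / J ^ n → S / K ^ n` induced by a ring homomorphism that maps `J`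
into `K`. -/
noncomputable def evalMap (h : J.map f ≤ K) (n : ℕ) : AdicCompletion J A →+* S ⧸ K ^ n :=
  (Ideal.quotientMap (K ^ n) f (pow_le_comap_pow h n)).comp
    (evalₐ J n : AdicCompletion J A →+* A ⧸ J ^ n)

theorem factorPow_comp_evalMap (h : J.map f ≤ K) {m n : ℕ} (hle : m ≤ n) :
    (Ideal.Quotient.factorPow K hle).comp (evalMap J K f h n) = evalMap J K f h m := by
  ext x
  obtain ⟨x, rfl⟩ := AdicCompletion.mk_surjective _ _ x
  have h' := congrArg (Ideal.quotientMap (K ^ m) f (pow_le_comap_pow h m))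
    (AdicCompletion.Ideal.mk_eq_mk J hle x)
  simp only [evalMap, RingHom.comp_apply, RingHom.coe_coe, evalₐ_mk, Ideal.quotientMap_mk] at h' ⊢
  exact h'

/-- The map on adic completions induced by a ring homomorphism that maps `J` into `K`. -/
noncomputable def mapRingHom (h : J.map f ≤ K) : AdicCompletion J A →+* AdicCompletion K S :=
  liftRingHom K (evalMap J K f h) (factorPow_comp_evalMap J K f h)

theorem mapRingHom_algebraMap (h : J.map f ≤ K) (a : A) :
    mapRingHom J K f h (algebraMap A _ a) = algebraMap S _ (f a) := by
  refine ext_evalₐ fun n ↦ ?_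
  rw [mapRingHom, evalₐ_liftRingHom, AlgHom.commutes, evalMap, RingHom.comp_apply,
    RingHom.coe_coe, AlgHom.commutes]
  rfl

/-- Modulo the ideal generated by `J`, surjectivity comes from `f`; it lifts because the source is
complete and the target Hausdorff. -/
theorem mapRingHom_surjective (hJ : J.FG) (h : J.map f = K) (hf : Function.Surjective f) :
    Function.Surjective (mapRingHom J K f h.le) := by
  subst h
  have := AdicCompletion.isAdicComplete_self J hJ
  have hK := hJ.map f
  have hmap : (J.map (algebraMap A (AdicCompletion J A))).map (mapRingHom J _ f le_rfl) =
      (J.map f).map (algebraMap S (AdicCompletion (J.map f) S)) := by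
    rw [Ideal.map_map, Ideal.map_map]
    exact congrArg (J.map ·) (RingHom.ext (mapRingHom_algebraMap J _ f le_rfl))
  have : IsHausdorff ((J.map (algebraMap A (AdicCompletion J A))).map
      (mapRingHom J _ f le_rfl)) (AdicCompletion (J.map f) S) := by
    rw [hmap]
    exact (AdicCompletion.isAdicComplete_self _ hK).toIsHausdorff
  refine surjective_of_mk_map_comp_surjective (I := J.map (algebraMap A (AdicCompletion J A)))
    (mapRingHom J _ f le_rfl) fun y ↦ ?_
  obtain ⟨y, rfl⟩ := Ideal.Quotient.mk_surjective y
  obtain ⟨s, hs⟩ := Ideal.Quotient.mk_surjective (evalₐ (J.map f) 1 y)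
  obtain ⟨a, rfl⟩ := hf s
  refine ⟨algebraMap A _ a, ?_⟩
  rw [RingHom.comp_apply, mapRingHom_algebraMap, Ideal.Quotient.mk_eq_mk_iff_sub_mem, hmap]
  have hmem := mem_map_pow_of_evalₐ_eq_zero (J.map f) hK 1 (x := algebraMap S _ (f a) - y) ?_
  · rwa [pow_one] at hmem
  rw [map_sub, AlgHom.commutes, sub_eq_zero]
  exact hs

/-- Sending variables to generators of `I` exhibits the completion as a quotient of a power series
ring in finitely many variables. -/
theorem isNoetherianRing [IsNoetherianRing R] : IsNoetherianRing (AdicCompletion I R) := by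
  obtain ⟨s, hs⟩ := (inferInstance : IsNoetherianRing R).noetherian I
  let f : MvPolynomial s R →+* R := (MvPolynomial.aeval (fun i : s ↦ (i : R))).toRingHom
  have hf : Function.Surjective f := fun r ↦ ⟨MvPolynomial.C r, by simp [f]⟩
  have hmap : (MvPolynomial.idealOfVars s R).map f = I := by
    rw [MvPolynomial.idealOfVars, Ideal.map_span, ← Set.range_comp, ← hs]
    congr 1
    ext x
    simp [f]
  have : IsNoetherianRing (AdicCompletion (MvPolynomial.idealOfVars s R) (MvPolynomial s R)) :=
    isNoetherianRing_of_ringEquiv (MvPowerSeries s R)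
      (MvPowerSeries.toAdicCompletionAlgEquiv s R).toRingEquiv
  exact isNoetherianRing_of_surjective _ _ _
    (mapRingHom_surjective _ I f (IsNoetherian.noetherian _) hmap hf)

end Noetherian

end AdicCompletion

/-- Contracting an extended ideal gives it back, so extension embeds the ideals of `A` into those of
`C`. -/
theorem Module.FaithfullyFlat.isNoetherianRing (A C : Type*) [CommRing A] [CommRing C]
    [Algebra A C] [Module.FaithfullyFlat A C] [IsNoetherianRing C] : IsNoetherianRing A := by
  let e : Ideal A ↪o Ideal C := OrderEmbedding.ofMapLEIff (Ideal.map (algebraMap A C)) fun I J ↦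
    ⟨fun h ↦ by
      rw [← Ideal.comap_map_eq_self_of_faithfullyFlat (B := C) I,
        ← Ideal.comap_map_eq_self_of_faithfullyFlat (B := C) J]
      exact Ideal.comap_mono h, Ideal.map_mono⟩
  rw [isNoetherianRing_iff, isNoetherian_iff']
  exact e.strictMono.wellFoundedGT

namespace PRadical

/-! ### Uniform Frobenius powers and adic density -/

section Frobenius

/-- The subring of all elements of `B` whose `p ^ ν`-th power comes from `R`. -/
def powMemRange (R B : Type*) [CommRing R] [CommRing B] [Algebra R B] (p ν : ℕ) [ExpChar B p] :
    Subring B :=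
  (algebraMap R B).range.comap (iterateFrobenius B p ν)

variable {R B : Type*} [CommRing R] [CommRing B] [Algebra R B] {p ν : ℕ} [ExpChar B p]

theorem mem_powMemRange {b : B} :
    b ∈ powMemRange R B p ν ↔ b ^ p ^ ν ∈ (algebraMap R B).range := by
  rw [powMemRange, Subring.mem_comap, iterateFrobenius_def]

theorem exists_powMemRange_of_finset (s : Finset B)
    (h : ∀ b ∈ s, ∃ ν : ℕ, b ^ p ^ ν ∈ (algebraMap R B).range) :
    ∃ ν : ℕ, ∀ b ∈ s, b ∈ powMemRange R B p ν := by
  choose! f hf using h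
  refine ⟨s.sup f, fun b hb ↦ ?_⟩
  rw [mem_powMemRange, ← Nat.add_sub_of_le (Finset.le_sup (f := f) hb), pow_add, pow_mul]
  exact pow_mem (hf b hb) _

variable {s : Set B}

theorem exists_sub_mem_pow_succ (S : Subring B) (hs : s ⊆ S)
    (hres : ∀ b : B, ∃ c ∈ S, b - c ∈ Ideal.span s) (k : ℕ) {b : B} (hb : b ∈ Ideal.span s ^ k) :
    ∃ c ∈ S, b - c ∈ Ideal.span s ^ (k + 1) := by
  -- Degree one is separate: higher degrees multiply approximations of the factors.
  have hone : ∀ b ∈ Ideal.span s, ∃ c ∈ S, b - c ∈ Ideal.span s ^ 2 := by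
    intro b hb
    induction hb using Submodule.span_induction with
    | mem x hx => exact ⟨x, hs hx, by simp⟩
    | zero => exact ⟨0, zero_mem _, by simp⟩
    | add x y _ _ hx hy =>
      obtain ⟨c, hc, hxc⟩ := hx
      obtain ⟨d, hd, hyd⟩ := hy
      exact ⟨c + d, add_mem hc hd, by rw [add_sub_add_comm]; exact add_mem hxc hyd⟩
    | smul a x hx ih =>
      obtain ⟨c, hc, hxc⟩ := ih
      obtain ⟨r, hr, har⟩ := hres a
      have hcs : c ∈ Ideal.span s := by
        rw [← sub_sub_cancel x c]
        exact sub_mem hx (Ideal.pow_le_self two_ne_zero hxc)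
      refine ⟨r * c, mul_mem hr hc, ?_⟩
      rw [smul_eq_mul, show a * x - r * c = a * (x - c) + (a - r) * c by ring]
      exact add_mem (Ideal.mul_mem_left _ _ hxc) (by rw [sq]; exact Ideal.mul_mem_mul har hcs)
  induction k generalizing b with
  | zero => simpa using hres b
  | succ k ih =>
    rw [pow_succ] at hb
    induction hb using Submodule.mul_induction_on' with
    | mem_mul_mem x hx y hy =>
      obtain ⟨c, hc, hxc⟩ := ih hx
      obtain ⟨d, hd, hyd⟩ := hone y hy
      have hck : c ∈ Ideal.span s ^ k := by
        rw [← sub_sub_cancel x c]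
        exact sub_mem hx (Ideal.pow_le_pow_right k.le_succ hxc)
      refine ⟨c * d, mul_mem hc hd, ?_⟩
      rw [show x * y - c * d = (x - c) * y + c * (y - d) by ring]
      refine add_mem ?_ ?_
      · rw [pow_succ]; exact Ideal.mul_mem_mul hxc hy
      · rw [add_assoc, pow_add]; exact Ideal.mul_mem_mul hck hyd
    | add x _ y _ hx hy =>
      obtain ⟨c, hc, hxc⟩ := hx
      obtain ⟨d, hd, hyd⟩ := hy
      exact ⟨c + d, add_mem hc hd, by rw [add_sub_add_comm]; exact add_mem hxc hyd⟩

/-- If `B = S + I` and the ideal `I` is generated by elements of the subring `S`, then `S` is dense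
for the `I`-adic topology. -/
theorem exists_sub_mem_pow (S : Subring B) (hs : s ⊆ S)
    (hres : ∀ b : B, ∃ c ∈ S, b - c ∈ Ideal.span s) (k : ℕ) (b : B) :
    ∃ c ∈ S, b - c ∈ Ideal.span s ^ k := by
  induction k with
  | zero => exact ⟨0, zero_mem _, by simp⟩
  | succ k ih =>
    obtain ⟨c, hc, hbc⟩ := ih
    obtain ⟨d, hd, hbd⟩ := exists_sub_mem_pow_succ S hs hres k hbc
    exact ⟨c + d, add_mem hc hd, by rwa [← sub_sub]⟩

/-- If `I` is finitely generated, `B = R + I` and every element of `B` has a `p ^ ν`-th power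
in `R`, then for some uniform `ν` all `p ^ ν`-th powers lie in the `I`-adic closure of `R`. -/
theorem exists_pow_sub_algebraMap_mem {I : Ideal B} (hI : I.FG)
    (hres : ∀ b : B, ∃ r : R, b - algebraMap R B r ∈ I)
    (hpow : ∀ b : B, ∃ ν : ℕ, b ^ p ^ ν ∈ (algebraMap R B).range) :
    ∃ ν : ℕ, ∀ (k : ℕ) (b : B), ∃ r : R, b ^ p ^ ν - algebraMap R B r ∈ I ^ k := by
  obtain ⟨s, rfl⟩ := hI
  obtain ⟨ν, hν⟩ := exists_powMemRange_of_finset (R := R) (p := p) s fun b _ ↦ hpow b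
  refine ⟨ν, fun k b ↦ ?_⟩
  obtain ⟨c, hc, hbc⟩ := exists_sub_mem_pow (powMemRange R B p ν) hν (fun b ↦ by
    obtain ⟨r, hr⟩ := hres b
    exact ⟨_, mem_powMemRange.mpr (pow_mem (RingHom.mem_range_self _ r) _), hr⟩) k b
  obtain ⟨r, hr⟩ := mem_powMemRange.mp hc
  refine ⟨r, ?_⟩
  rw [hr, ← sub_pow_expChar_pow]
  exact Ideal.pow_mem_of_mem _ hbc _ (expChar_pow_pos B p ν)

end Frobenius

/-! ### The induced map into a complete local ring -/

section Lift

variable {A : Type u} {C : Type v} [CommRing A] [IsLocalRing A] [CommRing C] [IsLocalRing C]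
  (φ : A →+* C) [IsLocalHom φ]

theorem truncatedMap_eq_mk {n : ℕ} {x : FormalCompletion A} {a : A}
    (h : AdicCompletion.evalₐ (maximalIdeal A) n x = Ideal.Quotient.mk _ a) :
    truncatedMap φ n x = Ideal.Quotient.mk _ (φ a) := by
  rw [truncatedMap, RingHom.comp_apply, RingHom.coe_coe, h, Ideal.quotientMap_mk]

variable [IsAdicComplete (maximalIdeal C) C]

theorem mk_completionLift (n : ℕ) (x : FormalCompletion A) :
    Ideal.Quotient.mk (maximalIdeal C ^ n) (completionLift φ x) = truncatedMap φ n x :=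
  IsAdicComplete.mk_liftRingHom _ _ _ _ _

theorem eq_of_forall_mk_eq {x y : C}
    (h : ∀ n, Ideal.Quotient.mk (maximalIdeal C ^ n) x = Ideal.Quotient.mk _ y) : x = y := by
  rw [IsHausdorff.eq_iff_smodEq (I := maximalIdeal C)]
  intro n
  rw [SModEq.sub_mem, smul_eq_mul, Ideal.mul_top]
  exact Ideal.Quotient.eq.mp (h n)

theorem completionLift_algebraMap (a : A) : completionLift φ (algebraMap A _ a) = φ a :=
  eq_of_forall_mk_eq fun n ↦ by
    rw [mk_completionLift, truncatedMap_eq_mk φ (a := a)]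
    exact AlgHom.commutes _ a

theorem flat_of_bijective_completionLift [Algebra A C] [IsLocalHom (algebraMap A C)]
    [IsNoetherianRing A] (h : Function.Bijective (completionLift (algebraMap A C))) :
    Module.Flat A C := by
  let e : FormalCompletion A ≃ₗ[A] C := LinearEquiv.ofBijective
    { completionLift (algebraMap A C) with
      map_smul' a x := by
        change completionLift (algebraMap A C) (a • x) = a • completionLift (algebraMap A C) x
        rw [Algebra.smul_def, map_mul, completionLift_algebraMap, Algebra.smul_def] } h
  exact Module.Flat.of_linearEquiv e.symm

end Lift

/-! ### Reducedness of the generic formal fiber -/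

section GenericFormalFiber

variable {A : Type u} [CommRing A] [IsLocalRing A] [IsDomain A]

theorem isReduced_of_hasReducedGenericFormalFibers [IsNoetherianRing A]
    (h : HasReducedGenericFormalFibers A) : IsReduced (FormalCompletion A) := by
  have := h ⊥ (by rw [IsDomain.minimalPrimes_eq_singleton_bot]; rfl)
  refine isReduced_of_injective (Algebra.TensorProduct.includeLeft :
    FormalCompletion A →ₐ[A] FormalCompletion A ⊗[A] (⊥ : Ideal A).ResidueField) ?_
  -- Flatness of the completion over noetherian `A` preserves the injectivity of `A → Frac A`.
  exact Algebra.TensorProduct.includeLeft_injective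
    (IsFractionRing.injective A (⊥ : Ideal A).ResidueField)

theorem hasReducedGenericFormalFibers_of_isReduced [IsReduced (FormalCompletion A)] :
    HasReducedGenericFormalFibers A := by
  intro 𝔭 _ h𝔭
  rw [IsDomain.minimalPrimes_eq_singleton_bot] at h𝔭
  obtain rfl : 𝔭 = ⊥ := h𝔭
  -- The fiber is the localization of `Â` at the nonzero elements of `A`.
  exact isReduced_localizationPreserves
    (Algebra.algebraMapSubmonoid (FormalCompletion A) (nonZeroDivisors A)) _ inferInstance

end GenericFormalFiber

/-! ### Comparison of `B̂` with `R̂` -/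

section Main

variable {R : Type u} [CommRing R] [IsLocalRing R] [IsNoetherianRing R]

theorem mem_pow_of_algebraMap_mem_pow {r : R} {n : ℕ}
    (h : algebraMap R (FormalCompletion R) r ∈ maximalIdeal (FormalCompletion R) ^ n) :
    r ∈ maximalIdeal R ^ n := by
  rw [AdicCompletion.maximalIdeal_eq_map, ← Ideal.map_pow] at h
  have := AdicCompletion.evalₐ_eq_zero_of_mem _ h
  rw [AlgHom.commutes] at this
  exact Ideal.Quotient.eq_zero_iff_mem.mp this

theorem exists_sub_algebraMap_mem_pow (x : FormalCompletion R) (n : ℕ) :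
    ∃ r : R, AdicCompletion.evalₐ (maximalIdeal R) n x = Ideal.Quotient.mk _ r ∧
      x - algebraMap R _ r ∈ maximalIdeal (FormalCompletion R) ^ n := by
  obtain ⟨r, hr⟩ := Ideal.Quotient.mk_surjective (AdicCompletion.evalₐ (maximalIdeal R) n x)
  refine ⟨r, hr.symm, ?_⟩
  rw [AdicCompletion.maximalIdeal_eq_map, ← Ideal.map_pow]
  refine AdicCompletion.mem_map_pow_of_evalₐ_eq_zero _ (maximalIdeal R).fg_of_isNoetherianRing _ ?_
  rw [map_sub, AlgHom.commutes, sub_eq_zero, ← hr]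
  rfl

variable {B : Type u} [CommRing B] [Algebra R B] [Algebra B (FormalCompletion R)]
  [IsScalarTower R B (FormalCompletion R)]

theorem isLocalHom_algebraMap_of_tower : IsLocalHom (algebraMap R B) := by
  have : IsLocalHom ((algebraMap B (FormalCompletion R)).comp (algebraMap R B)) := by
    rw [← IsScalarTower.algebraMap_eq]
    infer_instance
  exact isLocalHom_of_comp _ (algebraMap B (FormalCompletion R))

variable [IsLocalRing B] [IsLocalHom (algebraMap B (FormalCompletion R))]

theorem completionLift_surjective :
    Function.Surjective (completionLift (algebraMap B (FormalCompletion R))) := by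
  have := isLocalHom_algebraMap_of_tower (R := R) (B := B)
  intro y
  refine ⟨AdicCompletion.liftRingHom (maximalIdeal B) (truncatedMap (algebraMap R B))
    (factorPow_comp_truncatedMap (algebraMap R B)) y, eq_of_forall_mk_eq fun n ↦ ?_⟩
  obtain ⟨r, hr, hyr⟩ := exists_sub_algebraMap_mem_pow y n
  rw [mk_completionLift, truncatedMap_eq_mk _ (a := algebraMap R B r),
    ← IsScalarTower.algebraMap_apply, eq_comm, Ideal.Quotient.eq]
  · exact hyr
  · rw [AdicCompletion.evalₐ_liftRingHom, truncatedMap_eq_mk _ hr]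

theorem completionLift_injective [IsNoetherianRing B] [IsReduced (FormalCompletion B)] (p : ℕ)
    [ExpChar B p] (hpow : ∀ b : B, ∃ ν : ℕ, b ^ p ^ ν ∈ (algebraMap R B).range) :
    Function.Injective (completionLift (algebraMap B (FormalCompletion R))) := by
  have := isLocalHom_algebraMap_of_tower (R := R) (B := B)
  have hres (b : B) : ∃ r : R, b - algebraMap R B r ∈ maximalIdeal B := by
    obtain ⟨r, -, hr⟩ := exists_sub_algebraMap_mem_pow (algebraMap B (FormalCompletion R) b) 1
    refine ⟨r, ?_⟩
    rw [pow_one, IsScalarTower.algebraMap_apply R B, ← map_sub, mem_maximalIdeal,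
      map_mem_nonunits_iff] at hr
    exact hr
  obtain ⟨ν, hν⟩ := exists_pow_sub_algebraMap_mem (p := p)
    (maximalIdeal B).fg_of_isNoetherianRing hres hpow
  rw [injective_iff_map_eq_zero]
  intro x hx
  -- It suffices that `x ^ p ^ ν` vanishes modulo each `𝔪_B ^ n`.
  refine eq_zero_of_pow_eq_zero (n := p ^ ν) (AdicCompletion.ext_evalₐ fun n ↦ ?_)
  obtain ⟨b, hb⟩ := Ideal.Quotient.mk_surjective (AdicCompletion.evalₐ (maximalIdeal B) n x)
  have hbn : algebraMap B (FormalCompletion R) b ∈ maximalIdeal (FormalCompletion R) ^ n := by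
    rw [← Ideal.Quotient.eq_zero_iff_mem, ← truncatedMap_eq_mk _ hb.symm, ← mk_completionLift, hx,
      map_zero]
  rw [map_pow, map_zero, ← hb, ← map_pow, Ideal.Quotient.eq_zero_iff_mem]
  obtain ⟨r, hr⟩ := hν n b
  -- Passing through `R` is essential: `𝔪_R̂ ^ n` contracts to `𝔪_R ^ n` in `R`, whereas its
  -- contraction to `B` is not known to be `𝔪_B ^ n`.
  have hrn : r ∈ maximalIdeal R ^ n := by
    refine mem_pow_of_algebraMap_mem_pow ?_
    rw [IsScalarTower.algebraMap_apply R B, ← sub_sub_cancel (b ^ p ^ ν) (algebraMap R B r),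
      map_sub, map_pow]
    exact sub_mem (Ideal.pow_mem_of_mem _ hbn _ (expChar_pow_pos B p ν))
      (maximalIdeal_pow_le_comap _ n hr)
  rw [← sub_add_cancel (b ^ p ^ ν) (algebraMap R B r)]
  exact add_mem hr (maximalIdeal_pow_le_comap (algebraMap R B) n hrn)

end Main

end PRadical

theorem proposition3p9 {R : Type*} [CommRing R] [IsLocalRing R] [IsNoetherianRing R]
    [IsDomain (PRadical.FormalCompletion R)]
    (B : Subalgebra R (PRadical.FormalCompletion R)) (hB : B ≤ PRadical.pRadicalClosure R) :
    haveI : IsLocalRing B := PRadical.isLocalRing_of_le hB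
    haveI : IsLocalHom (algebraMap B (PRadical.FormalCompletion R)) :=
      PRadical.isLocalHom_of_le hB
    (IsNoetherianRing B ∧ PRadical.HasReducedGenericFormalFibers B) ↔
      (Module.Flat B (PRadical.FormalCompletion R) ∧
        Function.Injective
          (PRadical.completionLift (algebraMap B (PRadical.FormalCompletion R)))) := by
  have : IsLocalRing B := PRadical.isLocalRing_of_le hB
  have : IsLocalHom (algebraMap B (PRadical.FormalCompletion R)) := PRadical.isLocalHom_of_le hB
  constructor
  · rintro ⟨_, hred⟩
    have := PRadical.isReduced_of_hasReducedGenericFormalFibers hred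
    have := PRadical.expChar_formalCompletion R
    have : ExpChar B (ringExpChar (FractionRing R)) :=
      (RingHom.expChar_iff (algebraMap B (PRadical.FormalCompletion R))
        Subtype.val_injective _).mpr inferInstance
    have hinj := PRadical.completionLift_injective (R := R) (B := B)
      (ringExpChar (FractionRing R)) fun b ↦ by
        obtain ⟨ν, r, hr⟩ := hB b.2
        exact ⟨ν, r, Subtype.ext hr⟩
    exact ⟨PRadical.flat_of_bijective_completionLift
      ⟨hinj, PRadical.completionLift_surjective⟩, hinj⟩
  · rintro ⟨_, hinj⟩
    have := Module.FaithfullyFlat.of_flat_of_isLocalHom (A := B) (B := PRadical.FormalCompletion R)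
    have := AdicCompletion.isNoetherianRing (maximalIdeal R)
    have := isReduced_of_injective _ hinj
    exact ⟨Module.FaithfullyFlat.isNoetherianRing B (PRadical.FormalCompletion R),
      PRadical.hasReducedGenericFormalFibers_of_isReduced⟩
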